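/- Let $m,n\ge 1$ and $l\ge 0$ be integers, and let $a_1,\dots,a_m$ and $b_1,\dots,b_n$ be real numbers with $a_ib_j\ge 0$ for all $i,j$ and $|a_i|<1$ for all $i$. Let $X=[x_{i,j}]_{1\le i\le m,\,1\le j\le n}$ be an array of independent random variables with $$\Pr(x_{i,j}=k)=\frac{(a_ib_j)^k}{1+a_ib_j},\qquad k\in\{0,1\},$$ the rows $i$ being numbered from bottom to top. An up/right-diagonal path from the bottom row to the top row meets every row in exactly one entry, each next entry lying to the north or to the north-east of the previous one; that is, it visits the entries $(1,j_1),(2,j_2),\dots,(m,j_m)$ for some $1\le j_1\le j_2\le\dots\le j_m\le n$. Let $$L^{01}_{m,n}:=\max_{1\le j_1\le\dots\le j_m\le n}\ \sum_{i=1}^m x_{i,j_i}$$ be the corresponding last passage time. Then $$\Pr(L^{01}_{m,n}\le l)=\prod_{i=1}^m\prod_{j=1}^n(1+a_ib_j)^{-1}\,\Big\langle\Big(\prod_{j=1}^n\prod_{k=1}^l(1+b_je^{\mathrm i\theta_k})\Big)\Big(\prod_{j=1}^m\prod_{k=1}^l(1-a_je^{-\mathrm i\theta_k})\Big)^{-1}\Big\rangle_{\mathrm{CUE}_l},$$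 where $\langle\,\cdot\,\rangle_{\mathrm{CUE}_l}$ denotes the average over $(\theta_1,\dots,\theta_l)\in[0,2\pi)^l$ with respect to the eigenvalue probability density of Haar distributed matrices in $U(l)$, $$\frac{1}{(2\pi)^l\,l!}\prod_{1\le j<k\le l}\big|e^{\mathrm i\theta_k}-e^{\mathrm i\theta_j}\big|^2$$ (for $l=0$ the average equals $1$). -/

import Mathlib

/-- The last passage time of an `m × n` array `x` (row `i` counted from the bottom, column `j`
from the left). A bottom-to-top up/right-diagonal path visits one entry in every row, each next
entry lying to the north or to the north-east of the previous one; it is given by the weakly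
increasing function `c` sending a row to the column in which the path meets that row.
The time is the maximum over all such paths of the sum of the entries visited. -/
def lastPassageTime {m n : ℕ} (x : Fin m → Fin n → ℕ) : ℕ :=
  (Finset.univ.filter fun c : Fin m → Fin n => ∀ i i' : Fin m, i ≤ i' → c i ≤ c i').sup
    fun c => ∑ i, x i (c i)

/-- The eigenvalue probability density function of Haar distributed matrices in `U(l)`. -/
noncomputable def cueDensity (l : ℕ) (θ : Fin l → ℝ) : ℝ :=
  1 / ((2 * Real.pi) ^ l * (l.factorial : ℝ)) *
    ∏ j : Fin l, ∏ k ∈ Finset.Ioi j,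
      ‖Complex.exp (Complex.I * (θ k : ℂ)) - Complex.exp (Complex.I * (θ j : ℂ))‖ ^ 2

/-- The average of a function of the eigenvalue angles in `[0, 2π)` with respect to the
eigenvalue probability density function of `U(l)`. -/
noncomputable def cueAverage (l : ℕ) (f : (Fin l → ℝ) → ℂ) : ℂ :=
  ∫ θ in Set.univ.pi fun _ : Fin l => Set.Ico (0 : ℝ) (2 * Real.pi),
    (cueDensity l θ : ℂ) * f θ

/-! The passage time to column `j` of the top row is weakly increasing in `j`, so bounds on it are
encoded by thresholds `c k`: columns before `c k` have passage time less than `k`. Removing the top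
row changes only the thresholds (`respectsThreshold_succ_iff`), and for fixed thresholds the
weighted sum over that row factorizes over the blocks from `c k` to `c (k + 1)`
(`sum_prod_updateThreshold`). The weighted number of arrays respecting `c` is the determinant of the
matrix with entries `g m (c (k + 1)) (k - i)`, where `g m c` lists the Fourier coefficients of the
symbol with `m` factors in `a` and the factors in `b` from column `c` on. Multilinearity in the
columns followed by column operations proves this by induction on the rows
(`sum_det_updateThreshold`, `sum_respectsThreshold`). For thresholds `0` up to `l` and `n` beyond,
the condition is that the last passage time is at most `l`, and the matrix is Toeplitz. Heine's
identity (`cueAverage_prod`) turns its determinant into the CUE average. The normalizing product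
comes from the Bernoulli laws. -/

open Finset Metric

/-! ### Threshold updates and factorization over blocks -/

/-- The effect on the threshold vector `c` of a top row whose unit entries are in the columns
`s`. -/
def updateThreshold (c : ℕ → ℕ) (s : Finset ℕ) (k : ℕ) : ℕ :=
  max (c k) ((s.filter fun j => c k ≤ j ∧ j < c (k + 1)).sup (· + 1))

/-- The weighted sum of `q` over the possible values of an updated threshold. -/
def blockSum (w : ℕ → ℂ) (u v : ℕ) (q : ℕ → ℂ) : ℂ :=
  q u + ∑ j ∈ Ico u v, (∏ i ∈ Ico u j, (1 + w i)) * w j * q (j + 1)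

/-- The product is expanded according to the last index at which `w` is chosen instead of `1`. -/
lemma blockSum_const (w : ℕ → ℂ) {u v : ℕ} (h : u ≤ v) (z : ℂ) :
    blockSum w u v (fun _ => z) = (∏ i ∈ Ico u v, (1 + w i)) * z := by
  induction v, h using Nat.le_induction with
  | base => simp [blockSum]
  | succ v h ih =>
    rw [blockSum] at ih ⊢
    rw [sum_Ico_succ_top h, ← add_assoc, ih, prod_Ico_succ_top h]
    ring

lemma blockSum_succ (w : ℕ → ℂ) {u v : ℕ} (h : u ≤ v) (q : ℕ → ℂ) :
    blockSum w u (v + 1) q = blockSum w u v q + w v * blockSum w u v (fun _ => q (v + 1)) := by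
  rw [blockSum_const w h, blockSum, blockSum, sum_Ico_succ_top h]
  ring

lemma updateThreshold_insert_of_not {c : ℕ → ℕ} {k N : ℕ} (s : Finset ℕ)
    (h : ¬ (c k ≤ N ∧ N < c (k + 1))) :
    updateThreshold c (insert N s) k = updateThreshold c s k := by
  rw [updateThreshold, filter_insert, if_neg h, updateThreshold]

lemma updateThreshold_insert {c : ℕ → ℕ} {k N : ℕ} {s : Finset ℕ} (hs : s ⊆ range N)
    (h : c k ≤ N ∧ N < c (k + 1)) : updateThreshold c (insert N s) k = N + 1 := by
  rw [updateThreshold, filter_insert, if_pos h, sup_insert]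
  have : (s.filter fun j => c k ≤ j ∧ j < c (k + 1)).sup (· + 1) ≤ N := by
    refine Finset.sup_le fun j hj => ?_
    exact mem_range.1 (hs (mem_filter.1 hj).1)
  simp only [max_def]
  split_ifs <;> omega

lemma exists_block {c : ℕ → ℕ} (c0 : c 0 = 0) {K N : ℕ} (h : N < c K) :
    ∃ k < K, c k ≤ N ∧ N < c (k + 1) := by
  classical
  have hex : ∃ k, N < c k := ⟨K, h⟩
  have hpos : Nat.find hex ≠ 0 := fun h0 => by
    have := Nat.find_spec hex
    rw [h0, c0] at this
    omega
  obtain ⟨k, hk⟩ := Nat.exists_eq_succ_of_ne_zero hpos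
  refine ⟨k, ?_, ?_, ?_⟩
  · have := Nat.find_min' hex h
    omega
  · exact not_lt.1 (Nat.find_min hex (by omega))
  · have := Nat.find_spec hex
    rwa [hk] at this

/-- The sum over the top row factorizes over the thresholds. -/
lemma sum_prod_updateThreshold (w : ℕ → ℂ) {c : ℕ → ℕ} (hc : Monotone c) (c0 : c 0 = 0) (l : ℕ)
    (N : ℕ) (hN : N ≤ c (l + 1)) (q : Fin (l + 1) → ℕ → ℂ) :
    ∑ s ∈ (range N).powerset, (∏ j ∈ s, w j) * ∏ k : Fin (l + 1), q k (updateThreshold c s k) =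
      ∏ k : Fin (l + 1), blockSum w (c k) (max (c k) (min N (c (k + 1)))) (q k) := by
  induction N generalizing q with
  | zero => simp [blockSum, updateThreshold]
  | succ N ih =>
    -- Column `N` lies in exactly one block. A unit there moves that threshold to `N + 1` whatever
    -- the rest of `s`, so its factor becomes constant; the other factors do not change.
    obtain ⟨k₀, hk₀, hb⟩ := exists_block c0 (show N < c (l + 1) by omega)
    have huniq : ∀ k : ℕ, k ≠ k₀ → ¬ (c k ≤ N ∧ N < c (k + 1)) := by
      rintro k hk ⟨h1, h2⟩
      rcases lt_or_gt_of_ne hk with h | h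
      · have := hc (show k + 1 ≤ k₀ from h)
        omega
      · have := hc (show k₀ + 1 ≤ k from h)
        omega
    set K : Fin (l + 1) := ⟨k₀, hk₀⟩ with hK
    have hKv : ∀ k : Fin (l + 1), k ≠ K → (k : ℕ) ≠ k₀ := fun k hk h => hk (Fin.ext h)
    rw [range_add_one, sum_powerset_insert (by simp), ih (by omega)]
    have hstep : ∀ s ∈ (range N).powerset,
        (∏ j ∈ insert N s, w j) * ∏ k : Fin (l + 1), q k (updateThreshold c (insert N s) k) =
        w N * ((∏ j ∈ s, w j) * ∏ k : Fin (l + 1),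
          Function.update q K (fun _ => q K (N + 1)) k (updateThreshold c s k)) := by
      intro s hs
      have hs' := mem_powerset.1 hs
      rw [prod_insert (fun h => by simpa using hs' h), mul_assoc]
      congr 2
      refine prod_congr rfl fun k _ => ?_
      by_cases hk : k = K
      · subst hk
        rw [Function.update_self, updateThreshold_insert hs' hb]
      · rw [Function.update_of_ne hk, updateThreshold_insert_of_not _ (huniq _ (hKv k hk))]
    rw [sum_congr rfl hstep, ← mul_sum, ih (by omega)]
    rw [← mul_prod_erase univ _ (mem_univ K), ← mul_prod_erase univ _ (mem_univ K),
      ← mul_prod_erase univ _ (mem_univ K)]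
    have e1 : ∀ k ∈ univ.erase K, blockSum w (c k) (max (c k) (min N (c (k + 1))))
        (Function.update q K (fun _ => q K (N + 1)) k) =
        blockSum w (c k) (max (c k) (min N (c (k + 1)))) (q k) := by
      intro k hk
      rw [Function.update_of_ne (ne_of_mem_erase hk)]
    have e2 : ∀ k ∈ univ.erase K, blockSum w (c k) (max (c k) (min (N + 1) (c (k + 1)))) (q k) =
        blockSum w (c k) (max (c k) (min N (c (k + 1)))) (q k) := by
      intro k hk
      have := huniq _ (hKv k (ne_of_mem_erase hk))
      have hm := hc (show (k : ℕ) ≤ k + 1 by omega)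
      congr 1
      omega
    rw [prod_congr rfl e1, prod_congr rfl e2, Function.update_self]
    have e3 : max (c K) (min N (c (K + 1))) = N := by
      simp only [hK]; omega
    have e4 : max (c K) (min (N + 1) (c (K + 1))) = N + 1 := by
      simp only [hK]; omega
    rw [e3, e4, blockSum_succ w hb.1]
    ring

/-! ### Determinants attached to thresholds -/

/-- A family of coefficients compatible with adjoining factors `1 + b z` and `(1 - a / z)⁻¹`. -/
structure IsCoeffFamily (n : ℕ) (a b : ℕ → ℂ) (g : ℕ → ℕ → ℤ → ℂ) : Prop where
  column : ∀ m c r, c < n → g m c r = g m (c + 1) r + b c * g m (c + 1) (r - 1)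
  row : ∀ m c r, g m c r = g (m + 1) c r - a m * g (m + 1) c (r + 1)
  eq_zero_of_pos : ∀ m r, 0 < r → g m n r = 0
  eq_zero_of_neg : ∀ c r, r < 0 → g 0 c r = 0
  eq_one : ∀ c, g 0 c 0 = 1

/-- The Toeplitz-like matrix attached to the thresholds `c`. -/
def thresholdMatrix (l : ℕ) (g : ℕ → ℤ → ℂ) (c : ℕ → ℕ) : Matrix (Fin l) (Fin l) ℂ :=
  Matrix.of fun i k => g (c (k + 1)) ((k : ℤ) - i)

namespace IsCoeffFamily

variable {n : ℕ} {a b : ℕ → ℂ} {g : ℕ → ℕ → ℤ → ℂ}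

/-- A telescoping sum: when `v` grows by one, the `column` relation splits the boundary term, and
its part of degree `r` cancels against part of the new summand. -/
lemma blockSum_eq (hg : IsCoeffFamily n a b g) (m : ℕ) (r : ℤ) {u v : ℕ} (huv : u ≤ v)
    (hv : v ≤ n) :
    blockSum (fun j => a m * b j) u v (fun d => g m d r) =
      g (m + 1) u r - a m * (∏ i ∈ Ico u v, (1 + a m * b i)) * g (m + 1) v (r + 1) := by
  induction v, huv using Nat.le_induction with
  | base => simp [blockSum, hg.row m u r]
  | succ v h ih =>
    rw [blockSum_succ _ h, ih (by omega), blockSum_const _ h, prod_Ico_succ_top h,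
      hg.row m (v + 1) r, hg.column (m + 1) v (r + 1) (by omega)]
    rw [add_sub_cancel_right]
    ring

lemma det_thresholdMatrix_zero (hg : IsCoeffFamily n a b g) (l : ℕ) (c : ℕ → ℕ) :
    (thresholdMatrix l (g 0) c).det = 1 := by
  rw [Matrix.det_of_isUpperTriangular]
  · simp [thresholdMatrix, hg.eq_one]
  · intro i k hik
    have hki : (k : ℕ) < i := hik
    exact hg.eq_zero_of_neg _ _ (by omega)

/-- By `blockSum_eq`, each column on the left is the corresponding column of the threshold matrix
minus a multiple of the next one. The last column has no correction, since there the coefficient has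
positive index at threshold `n`. -/
lemma det_blockSum (hg : IsCoeffFamily n a b g) (m l : ℕ) {c : ℕ → ℕ} (hc : Monotone c)
    (hcn : ∀ k, l < k → c k = n) :
    (Matrix.of fun i k : Fin l => blockSum (fun j => a m * b j) (c (k + 1)) (c (k + 1 + 1))
      (fun d => g m d ((k : ℤ) - i))).det = (thresholdMatrix l (g (m + 1)) c).det := by
  have hle : ∀ k, c k ≤ n := fun k => by
    have := hc (show k ≤ k + l + 1 by omega)
    rwa [hcn (k + l + 1) (by omega)] at this
  rcases l with _ | l
  · simp
  -- Reversing the order turns the next column into the preceding one, as the determinant criterion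
  -- below requires.
  rw [← Matrix.det_submatrix_equiv_self Fin.revPerm,
    ← Matrix.det_submatrix_equiv_self Fin.revPerm (thresholdMatrix _ _ _)]
  symm
  refine Matrix.det_eq_of_forall_col_eq_smul_add_pred
    (fun k : Fin l => a m * ∏ i ∈ Ico (c (k.succ.rev + 1)) (c (k.succ.rev + 1 + 1)),
      (1 + a m * b i)) ?_ ?_
  · intro i
    simp only [Matrix.submatrix_apply, thresholdMatrix, Matrix.of_apply, Fin.revPerm_apply]
    rw [hg.blockSum_eq m _ (hc (by omega)) (hle _), hcn (_ + 1 + 1) (by simp), hg.eq_zero_of_pos]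
    · simp
    · have := i.rev.isLt
      simp only [Fin.rev_zero, Fin.val_last]
      omega
  · intro i k
    simp only [Matrix.submatrix_apply, thresholdMatrix, Matrix.of_apply, Fin.revPerm_apply]
    rw [hg.blockSum_eq m _ (hc (by omega)) (hle _)]
    have : ((k.castSucc.rev : Fin (l + 1)) : ℕ) = (k.succ.rev : ℕ) + 1 := by
      simp [Fin.val_rev]; omega
    rw [this]
    push_cast
    rw [sub_add_eq_add_sub ((k.succ.rev : ℕ) : ℤ)]
    ring

lemma sum_det_updateThreshold (hg : IsCoeffFamily n a b g) (m l : ℕ) {c : ℕ → ℕ}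
    (hc : Monotone c) (c0 : c 0 = 0) (hcn : ∀ k, l < k → c k = n) :
    ∑ s ∈ (range n).powerset, (∏ j ∈ s, a m * b j) * (if updateThreshold c s 0 = 0 then
      (thresholdMatrix l (g m) (updateThreshold c s)).det else 0) =
      (thresholdMatrix l (g (m + 1)) c).det := by
  rw [← hg.det_blockSum m l hc hcn, Matrix.det_apply']
  -- The extra factor at index `0` encodes the condition that threshold `0` stays `0`.
  let q : Equiv.Perm (Fin l) → Fin (l + 1) → ℕ → ℂ := fun σ =>
    Fin.cons (fun d => if d = 0 then 1 else 0) (fun k d => g m d ((k : ℤ) - σ k))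
  have hq : ∀ s, (if updateThreshold c s 0 = 0 then
      (thresholdMatrix l (g m) (updateThreshold c s)).det else 0) =
      ∑ σ : Equiv.Perm (Fin l), ((Equiv.Perm.sign σ : ℤ) : ℂ) *
        ∏ k : Fin (l + 1), q σ k (updateThreshold c s k) := by
    intro s
    split_ifs with h <;> simp [Matrix.det_apply', Fin.prod_univ_succ, q, h, thresholdMatrix]
  simp_rw [hq, mul_sum]
  rw [sum_comm]
  refine sum_congr rfl fun σ _ => ?_
  simp_rw [mul_left_comm _ (((Equiv.Perm.sign σ : ℤ) : ℂ)) _, ← mul_sum]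
  rw [sum_prod_updateThreshold _ hc c0 l n (by rw [hcn _ (by omega)])]
  congr 1
  have hle : ∀ k, c k ≤ n := fun k => by
    have := hc (show k ≤ k + l + 1 by omega)
    rwa [hcn (k + l + 1) (by omega)] at this
  have hmax : ∀ k, max (c k) (min n (c (k + 1))) = c (k + 1) := fun k => by
    have := hle (k + 1)
    have := hc (show k ≤ k + 1 by omega)
    omega
  simp_rw [hmax]
  rw [Fin.prod_univ_succ]
  simp [q, blockSum, c0]

end IsCoeffFamily

/-! ### Fourier coefficients of the symbol -/

section

open Real

/-- The rational symbol `∏_{c ≤ j < n} (1 + b_j z) ∏_{i < m} (1 - a_i / z)⁻¹`. -/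
noncomputable def symbol (a b : ℕ → ℂ) (n m c : ℕ) (z : ℂ) : ℂ :=
  (∏ j ∈ Ico c n, (1 + b j * z)) * (∏ i ∈ range m, (1 - a i * z⁻¹))⁻¹

/-- The `r`-th Fourier coefficient of a function on the unit circle. -/
noncomputable def circleCoeff (f : ℂ → ℂ) (r : ℤ) : ℂ :=
  circleAverage (fun z => z ^ (-r) * f z) 0 1

lemma ne_zero_of_mem_sphere_zero_one {z : ℂ} (hz : z ∈ sphere (0 : ℂ) |1|) : z ≠ 0 := by
  rintro rfl
  simp at hz

lemma one_sub_mul_ne_zero {a z : ℂ} (ha : ‖a‖ < 1) (hz : ‖z‖ ≤ 1) : 1 - a * z ≠ 0 := by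
  intro h
  have h1 : ‖a * z‖ = 1 := by rw [← sub_eq_zero.1 h, norm_one]
  have h2 : ‖a * z‖ ≤ ‖a‖ := by
    rw [norm_mul]
    exact mul_le_of_le_one_right (norm_nonneg _) hz
  linarith

lemma one_sub_mul_inv_ne_zero {a z : ℂ} (ha : ‖a‖ < 1) (hz : z ∈ sphere (0 : ℂ) |1|) :
    1 - a * z⁻¹ ≠ 0 := by
  refine one_sub_mul_ne_zero ha ?_
  rw [mem_sphere_zero_iff_norm, abs_one] at hz
  rw [norm_inv, hz, inv_one]

lemma continuousOn_symbol {a : ℕ → ℂ} (ha : ∀ i, ‖a i‖ < 1) (b : ℕ → ℂ) (n m c : ℕ) :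
    ContinuousOn (symbol a b n m c) (sphere (0 : ℂ) |1|) := by
  have h0 : ∀ z ∈ sphere (0 : ℂ) |1|, z ≠ 0 := fun z hz => ne_zero_of_mem_sphere_zero_one hz
  unfold symbol
  refine ContinuousOn.mul (by fun_prop) (ContinuousOn.inv₀ ?_ ?_)
  · exact continuousOn_finsetProd _ fun i _ =>
      continuousOn_const.sub (continuousOn_const.mul (continuousOn_id.inv₀ h0))
  · intro z hz
    exact prod_ne_zero_iff.2 fun i _ => one_sub_mul_inv_ne_zero (ha i) hz

lemma circleIntegrable_zpow_mul {f : ℂ → ℂ} (hf : ContinuousOn f (sphere (0 : ℂ) |1|)) (r : ℤ) :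
    CircleIntegrable (fun z => z ^ r * f z) 0 1 :=
  ContinuousOn.circleIntegrable' <| ContinuousOn.mul
    (fun z hz => (continuousAt_zpow₀ z r
      (Or.inl (ne_zero_of_mem_sphere_zero_one hz))).continuousWithinAt) hf

lemma circleCoeff_column {a : ℕ → ℂ} (ha : ∀ i, ‖a i‖ < 1) (b : ℕ → ℂ) {n c : ℕ} (hc : c < n)
    (m : ℕ) (r : ℤ) :
    circleCoeff (symbol a b n m c) r = circleCoeff (symbol a b n m (c + 1)) r +
      b c * circleCoeff (symbol a b n m (c + 1)) (r - 1) := by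
  have hi := circleIntegrable_zpow_mul (continuousOn_symbol ha b n m (c + 1))
  unfold circleCoeff
  rw [← smul_eq_mul (b c), ← circleAverage_smul, ← circleAverage_add (hi _)
    ((hi _).const_smul)]
  refine circleAverage_congr_sphere fun z hz => ?_
  have hz0 := ne_zero_of_mem_sphere_zero_one hz
  simp only [Pi.add_apply, Pi.smul_apply, smul_eq_mul, symbol]
  rw [prod_eq_prod_Ico_succ_bot hc, neg_sub, sub_eq_add_neg, zpow_add₀ hz0, zpow_one]
  ring

lemma circleCoeff_row {a : ℕ → ℂ} (ha : ∀ i, ‖a i‖ < 1) (b : ℕ → ℂ) (n m c : ℕ) (r : ℤ) :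
    circleCoeff (symbol a b n m c) r = circleCoeff (symbol a b n (m + 1) c) r -
      a m * circleCoeff (symbol a b n (m + 1) c) (r + 1) := by
  have hi := circleIntegrable_zpow_mul (continuousOn_symbol ha b n (m + 1) c)
  unfold circleCoeff
  rw [← smul_eq_mul (a m), ← circleAverage_smul, ← circleAverage_sub (hi _)
    ((hi _).const_smul)]
  refine circleAverage_congr_sphere fun z hz => ?_
  have hz0 := ne_zero_of_mem_sphere_zero_one hz
  have h1 := one_sub_mul_inv_ne_zero (ha m) hz
  simp only [Pi.sub_apply, Pi.smul_apply, smul_eq_mul, symbol]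
  rw [prod_range_succ, mul_inv, neg_add, zpow_add₀ hz0, zpow_neg_one]
  linear_combination (-(z ^ (-r) * (∏ j ∈ Ico c n, (1 + b j * z)) *
    (∏ i ∈ range m, (1 - a i * z⁻¹))⁻¹)) * mul_inv_cancel₀ h1

/-- No `b` factor remains, so after `z ↦ z⁻¹` the integrand is holomorphic on the disc and vanishes
at `0`; the mean value property applies. -/
lemma circleCoeff_eq_zero_of_pos {a : ℕ → ℂ} (ha : ∀ i, ‖a i‖ < 1) (b : ℕ → ℂ) (n m : ℕ) {r : ℤ}
    (hr : 0 < r) : circleCoeff (symbol a b n m n) r = 0 := by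
  obtain ⟨k, rfl⟩ := Int.eq_ofNat_of_zero_le hr.le
  rw [circleCoeff, ← circleAverage_zero_one_congr_inv]
  have hd : DiffContOnCl ℂ (fun z : ℂ => z ^ k * (∏ i ∈ range m, (1 - a i * z))⁻¹)
      (ball 0 |1|) := by
    refine DifferentiableOn.diffContOnCl ?_
    rw [closure_ball _ (by simp)]
    refine DifferentiableOn.mul (by fun_prop) (DifferentiableOn.inv (by fun_prop) ?_)
    intro z hz
    refine prod_ne_zero_iff.2 fun i _ => one_sub_mul_ne_zero (ha i) ?_
    simpa using hz
  have := hd.circleAverage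
  rw [zero_pow (by omega), zero_mul] at this
  rw [← this]
  congr 1
  ext z
  simp [symbol]

lemma circleAverage_pow_mul_prod (b : ℕ → ℂ) (n c k : ℕ) :
    circleAverage (fun z : ℂ => z ^ k * ∏ j ∈ Ico c n, (1 + b j * z)) 0 1 = 0 ^ k := by
  have hd : DiffContOnCl ℂ (fun z : ℂ => z ^ k * ∏ j ∈ Ico c n, (1 + b j * z)) (ball 0 |1|) :=
    Differentiable.diffContOnCl (by fun_prop)
  simpa using hd.circleAverage

lemma circleCoeff_zero_row (a b : ℕ → ℂ) (n c k : ℕ) :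
    circleCoeff (symbol a b n 0 c) (-k) = 0 ^ k := by
  rw [← circleAverage_pow_mul_prod b n c k, circleCoeff]
  simp [symbol]

end

/-! ### Heine's identity -/

section

open Real MeasureTheory

lemma setIntegral_Ico_exp (f : ℂ → ℂ) :
    ∫ θ in Set.Ico (0 : ℝ) (2 * π), f (Complex.exp (Complex.I * θ)) =
      2 * π * circleAverage f 0 1 := by
  rw [integral_Ico_eq_integral_Ioc, ← intervalIntegral.integral_of_le (by positivity),
    circleAverage_def]
  have : (2 * (π : ℂ)) ≠ 0 := by simp [Real.pi_ne_zero]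
  simp only [circleMap, Complex.real_smul]
  push_cast
  rw [← mul_assoc, mul_inv_cancel₀ this, one_mul]
  simp [mul_comm]

lemma prod_norm_sub_sq_eq_sum {l : ℕ} (θ : Fin l → ℝ) :
    ((∏ j : Fin l, ∏ k ∈ Ioi j, ‖Complex.exp (Complex.I * (θ k : ℂ)) -
      Complex.exp (Complex.I * (θ j : ℂ))‖ ^ 2 : ℝ) : ℂ) =
    ∑ σ : Equiv.Perm (Fin l), ∑ τ : Equiv.Perm (Fin l),
      ((Equiv.Perm.sign σ : ℤ) : ℂ) * ((Equiv.Perm.sign τ : ℤ) : ℂ) *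
        ∏ k : Fin l, Complex.exp (Complex.I * θ k) ^ (-((τ k : ℤ) - σ k)) := by
  set z : Fin l → ℂ := fun k => Complex.exp (Complex.I * θ k) with hz
  have hz0 : ∀ k, z k ≠ 0 := fun k => Complex.exp_ne_zero _
  have hconj : ∀ k, (starRingEnd ℂ) (z k) = (z k)⁻¹ := fun k => by
    simp [hz, ← Complex.exp_conj, ← Complex.exp_neg]
  -- On the unit circle conjugation is inversion, so the squared Vandermonde modulus is a product of
  -- two determinants.
  have h1 : ((∏ j : Fin l, ∏ k ∈ Ioi j, ‖z k - z j‖ ^ 2 : ℝ) : ℂ) =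
      (Matrix.vandermonde z).det * (Matrix.vandermonde fun k => (z k)⁻¹).det := by
    rw [Matrix.det_vandermonde, Matrix.det_vandermonde, ← prod_mul_distrib]
    push_cast
    refine prod_congr rfl fun j _ => ?_
    rw [← prod_mul_distrib]
    refine prod_congr rfl fun k _ => ?_
    rw [← hconj, ← hconj, ← map_sub, Complex.mul_conj']
  rw [h1, ← Matrix.det_transpose, ← Matrix.det_transpose (Matrix.vandermonde fun k => (z k)⁻¹),
    Matrix.det_apply', Matrix.det_apply', sum_mul_sum]
  refine sum_congr rfl fun σ _ => sum_congr rfl fun τ _ => ?_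
  rw [mul_mul_mul_comm, ← prod_mul_distrib]
  congr 1
  refine prod_congr rfl fun k _ => ?_
  simp only [Matrix.transpose_apply, Matrix.vandermonde_apply]
  rw [neg_sub, zpow_sub₀ (hz0 k), zpow_natCast, zpow_natCast, inv_pow, div_eq_mul_inv]

/-- Expansion of a Toeplitz determinant over two permutations. -/
lemma sum_sum_prod_eq_factorial_mul_det {l : ℕ} (t : ℤ → ℂ) :
    ∑ σ : Equiv.Perm (Fin l), ∑ τ : Equiv.Perm (Fin l),
      ((Equiv.Perm.sign σ : ℤ) : ℂ) * ((Equiv.Perm.sign τ : ℤ) : ℂ) *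
        ∏ k : Fin l, t ((τ k : ℤ) - σ k) =
    l.factorial * (Matrix.of fun i k : Fin l => t ((k : ℤ) - i)).det := by
  have key : ∀ τ : Equiv.Perm (Fin l), ∑ σ : Equiv.Perm (Fin l),
      ((Equiv.Perm.sign σ : ℤ) : ℂ) * ((Equiv.Perm.sign τ : ℤ) : ℂ) *
        ∏ k : Fin l, t ((τ k : ℤ) - σ k) =
      (Matrix.of fun i k : Fin l => t ((k : ℤ) - i)).det := by
    intro τ
    -- Replacing `σ` by `σ * τ` and reindexing the product by `τ` removes `τ`, since its sign
    -- squares to one.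
    rw [Matrix.det_apply', ← Equiv.sum_comp (Equiv.mulRight τ)]
    refine sum_congr rfl fun σ _ => ?_
    have hs : ((Equiv.Perm.sign τ : ℤ) : ℂ) * ((Equiv.Perm.sign τ : ℤ) : ℂ) = 1 := by
      rw [← Int.cast_mul, ← Units.val_mul, Int.units_mul_self]
      simp
    simp only [Equiv.coe_mulRight, Equiv.Perm.sign_mul, Units.val_mul, Int.cast_mul,
      Matrix.of_apply, Equiv.Perm.mul_apply]
    rw [mul_assoc _ _ ((Equiv.Perm.sign τ : ℤ) : ℂ), hs, mul_one,
      Equiv.prod_comp τ (fun k => t ((k : ℤ) - σ k))]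
  rw [sum_comm, sum_congr rfl fun τ _ => key τ]
  simp [Fintype.card_perm]

/-- **Heine's identity**: averages of multiplicative functions over the eigenvalues of Haar
distributed unitary matrices are Toeplitz determinants. -/
lemma cueAverage_prod {f : ℂ → ℂ} (hf : ContinuousOn f (sphere (0 : ℂ) |1|)) (l : ℕ) :
    cueAverage l (fun θ => ∏ k, f (Complex.exp (Complex.I * θ k))) =
      (Matrix.of fun i k : Fin l => circleCoeff f ((k : ℤ) - i)).det := by
  have hr : (volume : Measure (Fin l → ℝ)).restrict
      (Set.univ.pi fun _ : Fin l => Set.Ico (0 : ℝ) (2 * π)) =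
      Measure.pi fun _ : Fin l => volume.restrict (Set.Ico (0 : ℝ) (2 * π)) := by
    rw [volume_pi, Measure.restrict_pi_pi]
  have hint : ∀ r : ℤ, Integrable (fun θ : ℝ => Complex.exp (Complex.I * θ) ^ (-r) *
      f (Complex.exp (Complex.I * θ))) (volume.restrict (Set.Ico (0 : ℝ) (2 * π))) := by
    intro r
    have := (circleIntegrable_zpow_mul hf (-r))
    rw [CircleIntegrable, intervalIntegrable_iff_integrableOn_Ico_of_le (by positivity)] at this
    simpa [circleMap, IntegrableOn, mul_comm] using this
  have hexp : ∀ θ : Fin l → ℝ, (cueDensity l θ : ℂ) * ∏ k, f (Complex.exp (Complex.I * θ k)) =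
      ∑ σ : Equiv.Perm (Fin l), ∑ τ : Equiv.Perm (Fin l),
      (1 / ((2 * π) ^ l * l.factorial) : ℂ) *
        (((Equiv.Perm.sign σ : ℤ) : ℂ) * ((Equiv.Perm.sign τ : ℤ) : ℂ)) *
        ∏ k : Fin l, (Complex.exp (Complex.I * θ k) ^ (-((τ k : ℤ) - σ k)) *
          f (Complex.exp (Complex.I * θ k))) := by
    intro θ
    rw [cueDensity, Complex.ofReal_mul, prod_norm_sub_sq_eq_sum, mul_assoc, sum_mul, mul_sum]
    refine sum_congr rfl fun σ _ => ?_
    rw [sum_mul, mul_sum]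
    refine sum_congr rfl fun τ _ => ?_
    rw [prod_mul_distrib]
    push_cast
    ring
  have hI : ∀ σ τ : Equiv.Perm (Fin l), Integrable (fun θ : Fin l → ℝ =>
      ∏ k : Fin l, (Complex.exp (Complex.I * θ k) ^ (-((τ k : ℤ) - σ k)) *
          f (Complex.exp (Complex.I * θ k))))
      (Measure.pi fun _ : Fin l => volume.restrict (Set.Ico (0 : ℝ) (2 * π))) :=
    fun σ τ => Integrable.fintype_prod (f := fun k (θ : ℝ) =>
      Complex.exp (Complex.I * θ) ^ (-((τ k : ℤ) - σ k)) * f (Complex.exp (Complex.I * θ)))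
      fun k => hint _
  rw [cueAverage, hr]
  simp_rw [hexp]
  rw [integral_finsetSum _ fun σ _ => integrable_finsetSum _ fun τ _ => (hI σ τ).const_mul _]
  simp_rw [integral_finsetSum _ fun τ _ => (hI _ τ).const_mul _, integral_const_mul]
  have hprod : ∀ σ τ : Equiv.Perm (Fin l), ∫ θ : Fin l → ℝ,
      ∏ k : Fin l, (Complex.exp (Complex.I * θ k) ^ (-((τ k : ℤ) - σ k)) *
          f (Complex.exp (Complex.I * θ k)))
      ∂(Measure.pi fun _ : Fin l => volume.restrict (Set.Ico (0 : ℝ) (2 * π))) =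
      (2 * π) ^ l * ∏ k : Fin l, circleCoeff f ((τ k : ℤ) - σ k) := by
    intro σ τ
    rw [integral_fintype_prod_eq_prod (fun k (θ : ℝ) =>
      Complex.exp (Complex.I * θ) ^ (-((τ k : ℤ) - σ k)) * f (Complex.exp (Complex.I * θ)))]
    rw [prod_congr rfl fun k _ => setIntegral_Ico_exp fun z => z ^ (-((τ k : ℤ) - σ k)) * f z,
      prod_mul_distrib]
    simp [circleCoeff]
  have hpi : ((2 * π : ℂ)) ^ l ≠ 0 := pow_ne_zero _ (by simp [Real.pi_ne_zero])
  have hl : (l.factorial : ℂ) ≠ 0 := by exact_mod_cast l.factorial_ne_zero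
  have hterm : ∀ (s t : ℂ), (1 / ((2 * π) ^ l * l.factorial) : ℂ) * s * ((2 * π) ^ l * t) =
      (l.factorial : ℂ)⁻¹ * (s * t) := by
    intro s t
    field_simp
  simp_rw [hprod, hterm, ← mul_sum]
  rw [sum_sum_prod_eq_factorial_mul_det, inv_mul_cancel_left₀ hl]

end

/-! ### Row recursion for passage times -/

/-- The last passage time to the top row over paths that end in one of the columns up to `j`. -/
def passageTimeTo {n : ℕ} : {m : ℕ} → (Fin m → Fin n → ℕ) → Fin n → ℕ
  | 0, _, _ => 0
  | m + 1, x, j =>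
    (Iic j).sup fun j' => passageTimeTo (fun i : Fin m => x i.castSucc) j' + x (Fin.last m) j'

lemma passageTimeTo_mono {m n : ℕ} (x : Fin m → Fin n → ℕ) : Monotone (passageTimeTo x) := by
  cases m with
  | zero => exact fun _ _ _ => le_rfl
  | succ m => exact fun j j' h => Finset.sup_mono (Iic_subset_Iic.2 h)

lemma sum_le_passageTimeTo {m n : ℕ} (x : Fin m → Fin n → ℕ) (p : Fin m → Fin n)
    (hp : ∀ i i', i ≤ i' → p i ≤ p i') (j : Fin n) (hj : ∀ i, p i ≤ j) :
    ∑ i, x i (p i) ≤ passageTimeTo x j := by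
  induction m generalizing j with
  | zero => simp
  | succ m ih =>
    rw [Fin.sum_univ_castSucc]
    refine le_trans (Nat.add_le_add_right (ih (fun i => x i.castSucc) (fun i => p i.castSucc)
      (fun i i' h => hp _ _ (Fin.castSucc_le_castSucc_iff.2 h)) (p (Fin.last m))
      fun i => hp _ _ (Fin.le_last _)) _) ?_
    exact Finset.le_sup (f := fun j' => passageTimeTo (fun i : Fin m => x i.castSucc) j' +
      x (Fin.last m) j') (mem_Iic.2 (hj _))

lemma exists_path_eq_passageTimeTo {m n : ℕ} (x : Fin m → Fin n → ℕ) (j : Fin n) :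
    ∃ p : Fin m → Fin n, (∀ i i', i ≤ i' → p i ≤ p i') ∧ (∀ i, p i ≤ j) ∧
      ∑ i, x i (p i) = passageTimeTo x j := by
  induction m generalizing j with
  | zero => exact ⟨Fin.elim0, fun i => i.elim0, fun i => i.elim0, by simp [passageTimeTo]⟩
  | succ m ih =>
    obtain ⟨j', hj', hsup⟩ := Finset.exists_mem_eq_sup (Iic j) ⟨j, mem_Iic.2 le_rfl⟩
      fun j' => passageTimeTo (fun i : Fin m => x i.castSucc) j' + x (Fin.last m) j'
    obtain ⟨p, hp, hpj, hsum⟩ := ih (fun i => x i.castSucc) j'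
    refine ⟨Fin.snoc (α := fun _ => Fin n) p j', ?_, ?_, ?_⟩
    · intro i i'
      induction i using Fin.lastCases with
      | last =>
        intro h
        rw [Fin.last_le_iff.1 h]
      | cast i =>
        induction i' using Fin.lastCases with
        | last => simpa using fun _ => hpj i
        | cast i' => simpa using hp i i'
    · intro i
      induction i using Fin.lastCases with
      | last => simpa using hj'
      | cast i => simpa using (hpj i).trans (mem_Iic.1 hj')
    · rw [Fin.sum_univ_castSucc]
      simp only [Fin.snoc_castSucc, Fin.snoc_last]
      rw [hsum]
      exact hsup.symm

lemma lastPassageTime_le_iff {m n : ℕ} (x : Fin m → Fin n → ℕ) (l : ℕ) :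
    lastPassageTime x ≤ l ↔ ∀ j, passageTimeTo x j ≤ l := by
  rw [lastPassageTime, Finset.sup_le_iff]
  constructor
  · intro h j
    obtain ⟨p, hp, -, hsum⟩ := exists_path_eq_passageTimeTo x j
    rw [← hsum]
    exact h p (by simpa using hp)
  · intro h p hp
    have hp' : ∀ i i', i ≤ i' → p i ≤ p i' := by simpa using hp
    rcases m with _ | m
    · simp
    · exact (sum_le_passageTimeTo x p hp' (p (Fin.last m)) fun i => hp' _ _ (Fin.le_last _)).trans
        (h _)

/-- The passage times to the columns before `c k` are less than `k`, for all `k ≤ l + 1`. -/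
def RespectsThreshold {m n : ℕ} (l : ℕ) (x : Fin m → Fin n → ℕ) (c : ℕ → ℕ) : Prop :=
  ∀ k ≤ l + 1, ∀ j : Fin n, (j : ℕ) < c k → passageTimeTo x j < k

lemma monotone_updateThreshold {c : ℕ → ℕ} (hc : Monotone c) (s : Finset ℕ) :
    Monotone (updateThreshold c s) := by
  refine monotone_nat_of_le_succ fun k => le_trans ?_ (le_max_left _ _)
  refine max_le (hc (Nat.le_succ k)) (Finset.sup_le fun j hj => ?_)
  exact (mem_filter.1 hj).2.2

lemma updateThreshold_eq_of_lt {n l : ℕ} {c : ℕ → ℕ} (hcn : ∀ k, l < k → c k = n)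
    (s : Finset ℕ) (k : ℕ) (hk : l < k) : updateThreshold c s k = n := by
  have : (s.filter fun j => c k ≤ j ∧ j < c (k + 1)) = ∅ := by
    refine filter_eq_empty_iff.2 fun j _ h => ?_
    rw [hcn k hk, hcn (k + 1) (by omega)] at h
    omega
  rw [updateThreshold, this, hcn k hk]
  simp

/-- A unit in a column `j` of the block from `c k` to `c (k + 1)` forces the earlier passage time
there to be less than `k`. By monotonicity this extends to all columns up to `j`, so the rightmost
such unit determines the new threshold. -/
lemma respectsThreshold_succ_iff {m n l : ℕ} {c : ℕ → ℕ} (hc : Monotone c) (c0 : c 0 = 0)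
    (hcn : ∀ k, l < k → c k = n) (x : Fin (m + 1) → Fin n → ℕ) (s : Finset ℕ)
    (hx : ∀ j, x (Fin.last m) j = if (j : ℕ) ∈ s then 1 else 0) :
    RespectsThreshold l x c ↔
      RespectsThreshold l (fun i : Fin m => x i.castSucc) (updateThreshold c s) := by
  set V := passageTimeTo fun i : Fin m => x i.castSucc with hV
  have hmono : Monotone V := passageTimeTo_mono _
  have hle : ∀ k, c k ≤ n := fun k => by
    have := hc (show k ≤ k + l + 1 by omega)
    rwa [hcn (k + l + 1) (by omega)] at this
  -- The columns before `c k` are closed downwards, so the running maximum can be dropped.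
  have h1 : RespectsThreshold l x c ↔
      ∀ k ≤ l + 1, ∀ j : Fin n, (j : ℕ) < c k → V j + (if (j : ℕ) ∈ s then 1 else 0) < k := by
    constructor
    · intro h k hk j hj
      rw [← hx]
      exact lt_of_le_of_lt (Finset.le_sup (f := fun j' => V j' + x (Fin.last m) j')
        (mem_Iic.2 le_rfl)) (h k hk j hj)
    · intro h k hk j hj
      have hk0 : 0 < k := by
        rcases Nat.eq_zero_or_pos k with rfl | h0
        · omega
        · exact h0
      refine (Finset.sup_lt_iff hk0).2 fun j' hj' => ?_
      rw [hx]
      exact h k hk j' (lt_of_le_of_lt (Fin.le_def.1 (mem_Iic.1 hj')) hj)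
  rw [h1]
  constructor
  · intro h k hk j hj
    rcases lt_or_ge (j : ℕ) (c k) with hjk | hjk
    · exact lt_of_le_of_lt (Nat.le_add_right _ _) (h k hk j hjk)
    · have hj' : (j : ℕ) < (s.filter fun j => c k ≤ j ∧ j < c (k + 1)).sup (· + 1) :=
        (lt_max_iff.1 hj).resolve_left (by omega)
      obtain ⟨i, hi, hji⟩ := Finset.lt_sup_iff.1 hj'
      obtain ⟨his, hik, hik'⟩ := mem_filter.1 hi
      have hin : i < n := lt_of_lt_of_le hik' (hle _)
      rcases hk.eq_or_lt with rfl | hk'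
      · rw [hcn (l + 1) (by omega)] at hik
        omega
      · have := h (k + 1) (by omega) ⟨i, hin⟩ hik'
        rw [if_pos his] at this
        have h2 := hmono (show j ≤ ⟨i, hin⟩ from Fin.le_def.2 (by simpa using Nat.lt_succ_iff.1 hji))
        change V j < k
        omega
  · intro h k hk j hj
    split_ifs with hjs
    -- The block containing `j` has index below `k`, which leaves room for the unit.
    · obtain ⟨k₀, hk₀, hb⟩ := exists_block c0 hj
      have : (j : ℕ) < updateThreshold c s k₀ :=
        lt_max_of_lt_right (Finset.lt_sup_iff.2 ⟨j, mem_filter.2 ⟨hjs, hb⟩, Nat.lt_succ_self _⟩)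
      have h2 : V j < k₀ := h k₀ (by omega) j this
      omega
    · exact h k hk j (lt_max_of_lt_left hj)

/-- A column before `c 0` would need a negative passage time; this disposes of updates that raise
threshold `0`. -/
lemma not_respectsThreshold {m n l : ℕ} {c : ℕ → ℕ} (hc : Monotone c) (c0 : c 0 ≠ 0)
    (hcn : ∀ k, l < k → c k = n) (x : Fin m → Fin n → ℕ) : ¬ RespectsThreshold l x c := by
  intro h
  have hn : c 0 ≤ n := by
    rw [← hcn (l + 1) (by omega)]
    exact hc (by omega)
  exact absurd (h 0 (by omega) ⟨0, by omega⟩ (Nat.pos_of_ne_zero c0)) (by omega)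

/-! ### Generating function of arrays -/

/-- The array of zeros and ones with ones in the row `i` in the columns `X i`. -/
def indicatorArray {m : ℕ} (n : ℕ) (X : Fin m → Finset ℕ) (i : Fin m) (j : Fin n) : ℕ :=
  if (j : ℕ) ∈ X i then 1 else 0

lemma sum_piFinset_succ {α : Type*} [DecidableEq α] {m : ℕ} (S : Finset α)
    (f : (Fin (m + 1) → α) → ℂ) :
    ∑ X ∈ Fintype.piFinset (fun _ : Fin (m + 1) => S), f X =
      ∑ s ∈ S, ∑ X ∈ Fintype.piFinset (fun _ : Fin m => S), f (Fin.snoc (α := fun _ => α) X s) := by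
  rw [← sum_product']
  refine sum_bij' (fun X _ => (X (Fin.last m), fun i => X i.castSucc))
    (fun p _ => Fin.snoc (α := fun _ => α) p.2 p.1) ?_ ?_ ?_ ?_ ?_
  · intro X hX
    rw [Fintype.mem_piFinset] at hX
    exact mem_product.2 ⟨hX _, Fintype.mem_piFinset.2 fun i => hX _⟩
  · intro p hp
    obtain ⟨h1, h2⟩ := mem_product.1 hp
    rw [Fintype.mem_piFinset] at h2 ⊢
    intro i
    induction i using Fin.lastCases with
    | last => simpa using h1
    | cast i => simpa using h2 i
  · intro X _
    exact Fin.snoc_init_self X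
  · intro p _
    simp
  · intro X _
    exact congrArg f (Fin.snoc_init_self X).symm

open Classical in
/-- The weighted number of arrays that respect given thresholds is a determinant. -/
lemma sum_respectsThreshold {n : ℕ} {a b : ℕ → ℂ} {g : ℕ → ℕ → ℤ → ℂ}
    (hg : IsCoeffFamily n a b g) (l m : ℕ) {c : ℕ → ℕ} (hc : Monotone c)
    (hcn : ∀ k, l < k → c k = n) :
    ∑ X ∈ Fintype.piFinset (fun _ : Fin m => (range n).powerset),
      (∏ i, ∏ j ∈ X i, a i * b j) *
        (if RespectsThreshold l (indicatorArray n X) c then 1 else 0) =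
      if c 0 = 0 then (thresholdMatrix l (g m) c).det else 0 := by
  by_cases c0 : c 0 = 0
  swap
  · rw [if_neg c0]
    refine sum_eq_zero fun X _ => ?_
    rw [if_neg (not_respectsThreshold hc c0 hcn _), mul_zero]
  rw [if_pos c0]
  induction m generalizing c with
  | zero =>
    rw [hg.det_thresholdMatrix_zero]
    have : ∀ X : Fin 0 → Finset ℕ, RespectsThreshold l (indicatorArray n X) c := by
      intro X k hk j hj
      refine Nat.pos_of_ne_zero ?_
      rintro rfl
      omega
    simp [this]
  | succ m ih =>
    rw [sum_piFinset_succ, ← hg.sum_det_updateThreshold m l hc c0 hcn]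
    refine sum_congr rfl fun s _ => ?_
    have hstep : ∀ X : Fin m → Finset ℕ,
        RespectsThreshold l (indicatorArray n (Fin.snoc (α := fun _ => Finset ℕ) X s)) c ↔
        RespectsThreshold l (indicatorArray n X) (updateThreshold c s) := by
      intro X
      rw [respectsThreshold_succ_iff hc c0 hcn _ s (by simp [indicatorArray])]
      have : (fun i : Fin m => indicatorArray n (Fin.snoc (α := fun _ => Finset ℕ) X s)
          i.castSucc) = indicatorArray n X := by
        ext i j
        simp [indicatorArray]
      rw [this]
    simp_rw [hstep, Fin.prod_univ_castSucc, Fin.snoc_castSucc, Fin.snoc_last, Fin.val_castSucc,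
      Fin.val_last, mul_right_comm _ (∏ j ∈ s, a m * b j), mul_comm _ (∏ j ∈ s, a m * b j)]
    rw [← mul_sum]
    congr 1
    by_cases hu : updateThreshold c s 0 = 0
    · rw [if_pos hu, ih (monotone_updateThreshold hc s) (updateThreshold_eq_of_lt hcn s) hu]
    · rw [if_neg hu]
      refine sum_eq_zero fun X _ => ?_
      rw [if_neg (not_respectsThreshold (monotone_updateThreshold hc s) hu
        (updateThreshold_eq_of_lt hcn s) _), mul_zero]

lemma isCoeffFamily_circleCoeff {a : ℕ → ℂ} (ha : ∀ i, ‖a i‖ < 1) (b : ℕ → ℂ) (n : ℕ) :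
    IsCoeffFamily n a b fun m c => circleCoeff (symbol a b n m c) where
  column m _ r hc := circleCoeff_column ha b hc m r
  row m c r := circleCoeff_row ha b n m c r
  eq_zero_of_pos m _ hr := circleCoeff_eq_zero_of_pos ha b n m hr
  eq_zero_of_neg c r hr := by
    obtain ⟨k, rfl⟩ := Int.exists_eq_neg_ofNat hr.le
    simpa [zero_pow (show k ≠ 0 by omega)] using circleCoeff_zero_row a b n c k
  eq_one c := by simpa using circleCoeff_zero_row a b n c 0

open Classical in
/-- The generating function of the arrays of zeros and ones with bounded last passage time is a
Toeplitz determinant. -/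
lemma sum_lastPassageTime_le {a : ℕ → ℂ} (ha : ∀ i, ‖a i‖ < 1) (b : ℕ → ℂ) (l m n : ℕ) :
    ∑ X ∈ (Fintype.piFinset fun _ : Fin m => (range n).powerset).filter
      (fun X => lastPassageTime (indicatorArray n X) ≤ l), ∏ i, ∏ j ∈ X i, a i * b j =
      (Matrix.of fun i k : Fin l => circleCoeff (symbol a b n m 0) ((k : ℤ) - i)).det := by
  -- Only the bound at level `l + 1` is active, and all columns of the matrix use threshold `0`.
  let c : ℕ → ℕ := fun k => if l < k then n else 0
  have hc : Monotone c := by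
    intro k k' h
    simp only [c]
    split_ifs <;> omega
  have h := sum_respectsThreshold (isCoeffFamily_circleCoeff ha b n) l m hc (fun k hk => if_pos hk)
  have hiff : ∀ x : Fin m → Fin n → ℕ, RespectsThreshold l x c ↔ lastPassageTime x ≤ l := by
    intro x
    rw [lastPassageTime_le_iff]
    constructor
    · intro h j
      exact Nat.lt_succ_iff.1 (h (l + 1) le_rfl j (by simp [c]))
    · intro h k hk j hj
      by_cases hlk : l < k
      · exact (h j).trans_lt hlk
      · simp [c, hlk] at hj
  rw [if_pos (by simp [c])] at h
  simp_rw [hiff, mul_ite, mul_one, mul_zero] at h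
  rw [sum_filter, h]
  congr 1
  ext i k
  simp [thresholdMatrix, c, k.isLt.not_ge]

/-! ### Bernoulli arrays and the final identity -/

open MeasureTheory ProbabilityTheory in
/-- The probability that an array of independent Bernoulli variables takes given values. -/
lemma measureReal_eq_indicatorArray {Ω : Type*} [MeasurableSpace Ω] {P : Measure Ω}
    {m n : ℕ} {a : Fin m → ℝ} {b : Fin n → ℝ} {x : Fin m → Fin n → Ω → ℕ}
    (hindep : iIndepFun (fun p : Fin m × Fin n => x p.1 p.2) P)
    (hlaw : ∀ i j, ∀ k ∈ ({0, 1} : Set ℕ),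
      P.real {ω | x i j ω = k} = (a i * b j) ^ k / (1 + a i * b j))
    (X : Fin m → Finset ℕ) :
    P.real {ω | ∀ i j, x i j ω = indicatorArray n X i j} =
      (∏ i, ∏ j, (1 + a i * b j)⁻¹) * ∏ i, ∏ j, (a i * b j) ^ indicatorArray n X i j := by
  have hset : {ω | ∀ i j, x i j ω = indicatorArray n X i j} =
      ⋂ p : Fin m × Fin n, x p.1 p.2 ⁻¹' {indicatorArray n X p.1 p.2} := by
    ext ω
    simp
  have h := hindep.meas_iInter (s := fun p => x p.1 p.2 ⁻¹' {indicatorArray n X p.1 p.2})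
    fun p => ⟨_, measurableSet_singleton _, rfl⟩
  rw [hset, measureReal_def, h, ENNReal.toReal_prod, Fintype.prod_prod_type, ← prod_mul_distrib]
  refine prod_congr rfl fun i _ => ?_
  rw [← prod_mul_distrib]
  refine prod_congr rfl fun j _ => ?_
  have hmem : indicatorArray n X i j ∈ ({0, 1} : Set ℕ) := by
    unfold indicatorArray
    split_ifs <;> simp
  exact (hlaw i j _ hmem).trans (by rw [div_eq_inv_mul])

open MeasureTheory in
-- The prescribed probabilities of `0` and `1` already add up to one.
lemma ae_forall_eq_zero_or_one {Ω : Type*} [MeasurableSpace Ω] {P : Measure Ω}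
    [IsProbabilityMeasure P] {m n : ℕ} {a : Fin m → ℝ} {b : Fin n → ℝ}
    (hab : ∀ i j, 0 ≤ a i * b j) {x : Fin m → Fin n → Ω → ℕ} (hmeas : ∀ i j, Measurable (x i j))
    (hlaw : ∀ i j, ∀ k ∈ ({0, 1} : Set ℕ),
      P.real {ω | x i j ω = k} = (a i * b j) ^ k / (1 + a i * b j)) :
    ∀ᵐ ω ∂P, ∀ i j, x i j ω = 0 ∨ x i j ω = 1 := by
  rw [ae_all_iff]
  intro i
  rw [ae_all_iff]
  intro j
  have hm : ∀ k, MeasurableSet {ω | x i j ω = k} := fun k =>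
    hmeas i j (measurableSet_singleton k)
  have hsum : P.real ({ω | x i j ω = 0} ∪ {ω | x i j ω = 1}) = 1 := by
    rw [measureReal_union (Set.disjoint_left.2 fun ω h0 h1 => by simp_all) (hm 1),
      hlaw i j 0 (by simp), hlaw i j 1 (by simp)]
    have := hab i j
    field_simp
  refine (prob_compl_eq_zero_iff ((hm 0).union (hm 1))).2 ?_
  rwa [measureReal_def, ENNReal.toReal_eq_one_iff] at hsum

open MeasureTheory ProbabilityTheory Classical in
lemma measureReal_lastPassageTime_le {Ω : Type*} [MeasurableSpace Ω] {P : Measure Ω}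
    [IsProbabilityMeasure P] {m n : ℕ} {a : Fin m → ℝ} {b : Fin n → ℝ}
    (hab : ∀ i j, 0 ≤ a i * b j) {x : Fin m → Fin n → Ω → ℕ} (hmeas : ∀ i j, Measurable (x i j))
    (hindep : iIndepFun (fun p : Fin m × Fin n => x p.1 p.2) P)
    (hlaw : ∀ i j, ∀ k ∈ ({0, 1} : Set ℕ),
      P.real {ω | x i j ω = k} = (a i * b j) ^ k / (1 + a i * b j)) (l : ℕ) :
    P.real {ω | lastPassageTime (fun i j => x i j ω) ≤ l} =
      (∏ i, ∏ j, (1 + a i * b j)⁻¹) *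
        ∑ X ∈ (Fintype.piFinset fun _ : Fin m => (range n).powerset).filter
          (fun X => lastPassageTime (indicatorArray n X) ≤ l),
          ∏ i, ∏ j, (a i * b j) ^ indicatorArray n X i j := by
  simp_rw [mul_sum, ← measureReal_eq_indicatorArray hindep hlaw]
  rw [← measureReal_biUnion_finset]
  · refine measureReal_congr ?_
    filter_upwards [ae_forall_eq_zero_or_one hab hmeas hlaw] with ω hω
    refine propext ?_
    change lastPassageTime (fun i j => x i j ω) ≤ l ↔ ω ∈ ⋃ X ∈ _, _
    simp only [Set.mem_iUnion, mem_filter, Set.mem_ofPred_eq, exists_prop]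
    constructor
    · intro h
      let X : Fin m → Finset ℕ := fun i =>
        (univ.filter fun j : Fin n => x i j ω = 1).map Fin.valEmbedding
      have hX : ∀ i j, x i j ω = indicatorArray n X i j := by
        intro i j
        rcases hω i j with h | h <;> simp [indicatorArray, X, h, Fin.val_inj]
      refine ⟨X, ⟨?_, ?_⟩, hX⟩
      · refine Fintype.mem_piFinset.2 fun i => mem_powerset.2 fun j hj => ?_
        obtain ⟨j, -, rfl⟩ := mem_map.1 hj
        exact mem_range.2 j.isLt
      · rwa [show indicatorArray n X = fun i j => x i j ω from
          funext fun i => funext fun j => (hX i j).symm]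
    · rintro ⟨X, ⟨-, h⟩, hX⟩
      rwa [show (fun i j => x i j ω) = indicatorArray n X from
        funext fun i => funext fun j => hX i j]
  · intro X hX Y hY hXY
    refine Set.disjoint_left.2 fun ω h1 h2 => hXY ?_
    simp only [coe_filter, Fintype.mem_piFinset, mem_powerset, Set.mem_ofPred_eq] at hX hY
    funext i
    ext j
    by_cases hj : j < n
    · have h := (h1 i ⟨j, hj⟩).symm.trans (h2 i ⟨j, hj⟩)
      unfold indicatorArray at h
      split_ifs at h <;> simp_all
    · exact iff_of_false (fun h => hj (mem_range.1 (hX.1 i h)))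
        fun h => hj (mem_range.1 (hY.1 i h))
  · intro X _
    simp only [Set.ofPred_forall]
    exact MeasurableSet.iInter fun i => MeasurableSet.iInter fun j =>
      hmeas i j (measurableSet_singleton _)

theorem mainTheorem5 {Ω : Type*} [MeasurableSpace Ω]
    (P : MeasureTheory.Measure Ω) [MeasureTheory.IsProbabilityMeasure P]
    (m n : ℕ) (a : Fin m → ℝ) (b : Fin n → ℝ)
    (hab : ∀ i j, 0 ≤ a i * b j) (ha : ∀ i, |a i| < 1)
    (x : Fin m → Fin n → Ω → ℕ)
    (hmeas : ∀ i j, Measurable (x i j))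
    (hindep : ProbabilityTheory.iIndepFun (fun p : Fin m × Fin n => x p.1 p.2) P)
    (hlaw : ∀ i j, ∀ k ∈ ({0, 1} : Set ℕ),
      P.real {ω | x i j ω = k} = (a i * b j) ^ k / (1 + a i * b j))
    (l : ℕ) :
    ((P.real {ω | lastPassageTime (fun i j => x i j ω) ≤ l} : ℝ) : ℂ) =
      ((∏ i, ∏ j, (1 + a i * b j)⁻¹ : ℝ) : ℂ) *
        cueAverage l (fun θ =>
          (∏ j : Fin n, ∏ k : Fin l, (1 + (b j : ℂ) * Complex.exp (Complex.I * (θ k : ℂ)))) *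
          (∏ i : Fin m, ∏ k : Fin l,
            (1 - (a i : ℂ) * Complex.exp (-(Complex.I * (θ k : ℂ)))))⁻¹) := by
  classical
  -- Extension by zero keeps every modulus below one and lets the row induction use indices in `ℕ`.
  let a' : ℕ → ℂ := fun i => if h : i < m then (a ⟨i, h⟩ : ℂ) else 0
  let b' : ℕ → ℂ := fun j => if h : j < n then (b ⟨j, h⟩ : ℂ) else 0
  have ha'_val : ∀ i : Fin m, a' i = a i := fun i => by simp [a']
  have hb'_val : ∀ j : Fin n, b' j = b j := fun j => by simp [b']
  have ha' : ∀ i, ‖a' i‖ < 1 := by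
    intro i
    by_cases h : i < m
    · simpa [a', h] using ha ⟨i, h⟩
    · simp [a', h]
  have hsymbol : ∀ θ : Fin l → ℝ,
      (∏ j : Fin n, ∏ k : Fin l, (1 + (b j : ℂ) * Complex.exp (Complex.I * (θ k : ℂ)))) *
          (∏ i : Fin m, ∏ k : Fin l,
            (1 - (a i : ℂ) * Complex.exp (-(Complex.I * (θ k : ℂ)))))⁻¹ =
      ∏ k, symbol a' b' n m 0 (Complex.exp (Complex.I * θ k)) := by
    intro θ
    rw [prod_comm, prod_comm (s := (univ : Finset (Fin m))), ← prod_inv_distrib,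
      ← prod_mul_distrib]
    refine prod_congr rfl fun k _ => ?_
    rw [symbol, ← range_eq_Ico, prod_range, prod_range]
    simp_rw [ha'_val, hb'_val, Complex.exp_neg]
  simp_rw [hsymbol]
  rw [cueAverage_prod (continuousOn_symbol ha' b' n m 0), ← sum_lastPassageTime_le ha',
    measureReal_lastPassageTime_le hab hmeas hindep hlaw, Complex.ofReal_mul]
  congr 1
  push_cast
  refine sum_congr rfl fun X hX => prod_congr rfl fun i _ => ?_
  have hXi : X i ⊆ range n :=
    mem_powerset.1 (Fintype.mem_piFinset.1 (mem_filter.1 hX).1 i)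
  -- The product over the units of a row becomes a product over all columns, with factor `1` off the
  -- units.
  rw [← inter_eq_right.2 hXi, ← prod_ite_mem, prod_range]
  refine prod_congr rfl fun j _ => ?_
  rw [ha'_val, hb'_val, indicatorArray]
  split_ifs <;> simp
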